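/- Let $u,f\in\mathbb C$ and consider the map $\varphi:(v_{n-1},d_n)\mapsto(v_n,d_{n+1})$, defined for $d_n\neq0$ by $$v_n=-v_{n-1}+\frac{u}{d_n},\qquad d_{n+1}=-d_n-v_n^2-f. \qquad (1)$$ Let $H(v,d)=d(v^2+d+f)-uv$ for $(v,d)\in\mathbb C^2$. (i) The map is integrable: at every point with $d_n\ne 0$ it is differentiable, it preserves the symplectic form, $dv_{n-1}\wedge dd_n=dv_n\wedge dd_{n+1}$, and it has the first integral $H(v_{n-1},d_n)=d_n(v_{n-1}^2+d_n+f)-uv_{n-1}$, i.e. $H(v_n,d_{n+1})=H(v_{n-1},d_n)$. The function $H$ has only finitely many critical points in $\mathbb C^2$; in particular all but finitely many of its level sets are nonsingular (contain no zero of $dH$). (ii) The general solution of the map is, up to an overall choice of sign, given by elliptic functions. For a lattice $\Lambda\subset\mathbb C$ let $\wp$ be its Weierstrass function and $\zeta(s)=\frac1s+\sum_{l\in\Lambda\setminus\{0\}}\big(\frac1{s-l}+\frac1l+\frac{s}{l^2}\big)$ its Weierstrass zeta function. For $z,z_0\in\mathbb C$ and a sign $\pm$ consider $$d_n=\wp(z)-\wp(z_0+nz),\qquad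 v_n=\pm\big(\zeta(z_0+(n+1)z)-\zeta(z_0+nz)-\zeta(z)\big), \qquad (2)$$ $$u=\pm\wp'(z),\qquad f=-3\wp(z),\qquad H=-\tfrac12\wp''(z), \qquad (3)$$ with the same sign in (2) and (3). For $I\subseteq\mathbb Z$, call a sequence of points $(v_{n-1},d_n)_{n\in I}$ a solution of the map on $I$ if $d_n\neq0$ and (1) holds whenever $n,n+1\in I$ (for instance $I=\mathbb Z$, or $I=\{0,1,2,\dots\}$). (a) Let $z\notin\Lambda$, and let $z_0+(n-1)z\notin\Lambda$ and $z_0+nz\notin\Lambda$ for all $n\in I$. Then, for either sign, (2) is a solution on $I$ with the parameters $u,f$ given by (3), and $H(v_{n-1},d_n)=-\frac12\wp''(z)$ for all $n\in I$. (b) Conversely, let $u,f\in\mathbb C$ be arbitrary, let $I$ be a nonempty set of consecutive integers (finite or infinite), and let $(v_{n-1},d_n)_{n\in I}$ be a solution on $I$ with these parameters that lies on a nonsingular level set $\{H=h\}$. Then, for either choice of the sign, there are a lattice $\Lambda$ and $z,z_0\in\mathbb C$ with $z\notin\Lambda$ and $z_0+(n-1)z,\ z_0+nz\notin\Lambda$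 for all $n\in I$, such that $u=\pm\wp'(z)$, $f=-3\wp(z)$, $h=-\frac12\wp''(z)$, and $v_{n-1}$ and $d_n$ are given by (2) for all $n\in I$. -/

import Mathlib

noncomputable section

namespace DToda

/-- The map `(v, d) ↦ (-v + u / d, -d - (-v + u / d)² - f)` with parameters `u, f`; it is considered
only on the domain `d ≠ 0`. -/
def map (u f : ℂ) (p : ℂ × ℂ) : ℂ × ℂ :=
  (-p.1 + u / p.2, -p.2 - (-p.1 + u / p.2) ^ 2 - f)

/-- The function `H(v, d) = d (v² + d + f) - u v`. -/
def H (u f : ℂ) (p : ℂ × ℂ) : ℂ :=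
  p.2 * (p.1 ^ 2 + p.2 + f) - u * p.1

/-- The constant 2-form `dv ∧ dd` on `ℂ²` with coordinates `(v, d)`. -/
def symplecticForm : (ℂ × ℂ) [⋀^Fin 2]→L[ℂ] ℂ where
  toFun w := (w 0).1 * (w 1).2 - (w 1).1 * (w 0).2
  map_update_add' := by
    intro inst m i x y
    rw [Subsingleton.elim inst (instDecidableEqFin 2)]
    fin_cases i <;> simp <;> ring
  map_update_smul' := by
    intro inst m i c x
    rw [Subsingleton.elim inst (instDecidableEqFin 2)]
    fin_cases i <;> simp <;> ring
  map_eq_zero_of_eq' := by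
    intro w i j hw hij
    fin_cases i <;> fin_cases j <;> simp_all
  cont := by fun_prop

/-- The level set `{H = h}` is nonsingular: `dH` does not vanish at any point of it. -/
def IsNonsingularLevel (u f h : ℂ) : Prop :=
  ∀ p : ℂ × ℂ, H u f p = h → fderiv ℂ (H u f) p ≠ 0

/-- The points `(v_{n-1}, d_n)`, for `n` in the set of indices `I`, form a (piece of an) orbit of the
map: whenever `n, n + 1 ∈ I`, the map is defined at `(v_{n-1}, d_n)` and sends it to
`(v_n, d_{n+1})`. -/
def IsSolutionOn (u f : ℂ) (I : Set ℤ) (v d : ℤ → ℂ) : Prop :=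
  ∀ n : ℤ, n ∈ I → n + 1 ∈ I →
    d n ≠ 0 ∧ v n = -v (n - 1) + u / d n ∧ d (n + 1) = -d n - v n ^ 2 - f

/-- The Weierstrass zeta function of the period lattice of `L`,
`ζ(z) = 1/z + ∑_{l ≠ 0} (1/(z - l) + 1/l + z/l²)`. As `1/0 = 0` in Lean, the term of the sum below
at `l = 0` is `1/z`. -/
def weierstrassZeta (L : PeriodPair) (z : ℂ) : ℂ :=
  ∑' l : L.lattice, (1 / (z - l) + 1 / (l : ℂ) + z / (l : ℂ) ^ 2)

/-- `d_n = ℘(z) - ℘(z₀ + n z)`. -/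
def ellipticD (L : PeriodPair) (z₀ z : ℂ) (n : ℤ) : ℂ :=
  L.weierstrassP z - L.weierstrassP (z₀ + n * z)

/-- `v_n = ε (ζ(z₀ + (n + 1) z) - ζ(z₀ + n z) - ζ(z))`, where `ε` is a sign. -/
def ellipticV (ε : ℂ) (L : PeriodPair) (z₀ z : ℂ) (n : ℤ) : ℂ :=
  ε * (weierstrassZeta L (z₀ + (n + 1) * z) - weierstrassZeta L (z₀ + n * z)
    - weierstrassZeta L z)

/-- No pole of `℘` or `ζ` is met in the formulas for `v_{n-1}` and `d_n`, `n ∈ I`. -/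
def AvoidsPoles (L : PeriodPair) (z₀ z : ℂ) (I : Set ℤ) : Prop :=
  z ∉ L.lattice ∧ ∀ n ∈ I, z₀ + (n - 1) * z ∉ L.lattice ∧ z₀ + n * z ∉ L.lattice

end DToda

end

open Filter Topology Complex

/-! ### The Weierstrass zeta function: convergence, derivative, quasi-periodicity. -/

namespace PeriodPair

variable (L : PeriodPair)

/-! Put a = z₀ + nz and W(z, a) = ζ(a + z) - ζ(a) - ζ(z) (`zetaDefect`), so that v_n = εW(z, a) and
v_{n-1} = εW(z, a - z). The elliptic side rests on the addition theorem W² = ℘(a) + ℘(z) + ℘(a + z)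
(`zetaDefect_sq`), which is the second equation of the map. Its derivative in a and the symmetry of
W give 2W(℘(a) - ℘(z)) = ℘'(a) - ℘'(z) (`zetaDefect_mul_sub`). Applied to z and -z, this is the
first equation; with the Weierstrass equation it gives the value of H (`zetaDefect_cubic`).

Conversely, X = -f/3 - d, y = ε(2vd - u) sends {H = h} to the cubic y² = 4X³ - g₂X - g₃ with g₂ =
4f²/3 + 4h and g₃ chosen so that (-f/3, εu) lies on it. A nonsingular level gives a nonzero
discriminant, so some lattice has these invariants (`exists_g₂_g₃`, from the surjectivity of j).
Take z over (-f/3, εu) and a over the image of one point of the orbit, with a separate argument when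
d = 0. Both equations of the map can be solved forwards and backwards, which spreads the formulas
over the whole interval (`elliptic_of_elliptic_at`). -/

lemma countable_lattice : (L.lattice : Set ℂ).Countable :=
  countable_of_Lindelof_of_discrete (X := L.lattice)

lemma isOpen_compl_lattice : IsOpen (L.lattice : Set ℂ)ᶜ :=
  L.isClosed_lattice.isOpen_compl

lemma isPreconnected_compl_lattice : IsPreconnected (L.lattice : Set ℂ)ᶜ :=
  (L.countable_lattice.isConnected_compl_of_one_lt_rank (by simp)).2

/-- A continuous doubly periodic function that is holomorphic off a countable set is constant. -/
lemma apply_eq_apply_of_periodic {f : ℂ → ℂ} {S : Set ℂ} (hS : S.Countable) (hf : Continuous f)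
    (hd : ∀ x ∉ S, DifferentiableAt ℂ f x) (hp : ∀ x, ∀ l ∈ L.lattice, f (x + l) = f x)
    (x y : ℂ) : f x = f y := by
  -- Cauchy's formula tolerates a countable exceptional set for continuous functions, so f is
  -- entire. Periodicity then makes it bounded, and Liouville applies.
  have hdiff : Differentiable ℂ f := fun c ↦
    (hasFPowerSeriesOnBall_of_differentiable_off_countable (R := 1) hS hf.continuousOn
      (fun x hx ↦ hd x hx.2) one_pos).analyticAt.differentiableAt
  exact hdiff.apply_eq_apply_of_bounded
    (IsZLattice.isCompact_range_of_periodic L.lattice f hf hp).isBounded x y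

/-- The three fractions combine to s² / (l² (s - l)), and |s - l| ≥ |l|/2. The exponent -3 is
summable over a lattice of rank 2. -/
lemma weierstrassZeta_bound (r : ℝ) (hr : 0 < r) (s : ℂ) (hs : ‖s‖ < r) (l : ℂ)
    (h : 2 * r ≤ ‖l‖) :
    ‖1 / (s - l) + 1 / l + s / l ^ 2‖ ≤ 2 * r ^ 2 * ‖l‖ ^ (-3 : ℝ) := by
  have hl : 0 < ‖l‖ := by linarith
  have hl0 : l ≠ 0 := norm_pos_iff.mp hl
  have hsl : s - l ≠ 0 := sub_ne_zero.mpr (by rintro rfl; linarith)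
  have hb : ‖l‖ / 2 ≤ ‖s - l‖ := by
    rw [norm_sub_rev]
    exact .trans (by linarith) (norm_sub_norm_le l s)
  calc
    _ = ‖s ^ 2 / (l ^ 2 * (s - l))‖ := by congr 1; field_simp; ring
    _ = ‖s‖ ^ 2 / (‖l‖ ^ 2 * ‖s - l‖) := by simp
    _ ≤ r ^ 2 / (‖l‖ ^ 2 * (‖l‖ / 2)) := by gcongr
    _ = 2 * r ^ 2 / ‖l‖ ^ 3 := by field
    _ = _ := by norm_cast

/-- The Weierstrass zeta function with the term `1/z` missing. -/
noncomputable def weierstrassZetaExcept (z : ℂ) : ℂ :=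
  ∑' l : L.lattice, if l.1 = 0 then 0 else (1 / (z - l) + 1 / (l : ℂ) + z / (l : ℂ) ^ 2)

lemma hasSumLocallyUniformly_weierstrassZetaExcept :
    HasSumLocallyUniformly
      (fun (l : L.lattice) (z : ℂ) ↦
        if l.1 = 0 then 0 else (1 / (z - l) + 1 / (l : ℂ) + z / (l : ℂ) ^ 2))
      L.weierstrassZetaExcept := by
  refine L.hasSumLocallyUniformly_aux (u := (2 * · ^ 2 * ‖·‖ ^ (-3 : ℝ))) _
    (fun _ _ ↦ (ZLattice.summable_norm_rpow _ _ (by simp; norm_num)).mul_left _) fun r hr ↦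
    Filter.eventually_atTop.mpr ⟨2 * r, ?_⟩
  rintro _ h s hs l rfl
  split_ifs
  · simpa using! show 0 ≤ 2 * r ^ 2 * (‖(l : ℂ)‖ ^ 3)⁻¹ by positivity
  · exact weierstrassZeta_bound r hr s hs l h

lemma weierstrassZeta_eq (z : ℂ) :
    DToda.weierstrassZeta L z = 1 / z + L.weierstrassZetaExcept z := by
  trans (∑' l : L.lattice, if l = 0 then 1 / z else 0) + L.weierstrassZetaExcept z
  · rw [DToda.weierstrassZeta, weierstrassZetaExcept, ← Summable.tsum_add]
    · congr with l
      by_cases hl : l = 0 <;> simp [hl]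
    · exact summable_of_hasFiniteSupport ((Set.finite_singleton (0 : L.lattice)).subset
        fun l hl ↦ by by_contra h; simp_all)
    · exact (L.hasSumLocallyUniformly_weierstrassZetaExcept.hasSum (x := z)).summable
  · simp

lemma differentiableOn_weierstrassZetaExcept :
    DifferentiableOn ℂ L.weierstrassZetaExcept (L.lattice \ {0})ᶜ := by
  refine L.hasSumLocallyUniformly_weierstrassZetaExcept.hasSumLocallyUniformlyOn.differentiableOn
    (.of_forall fun s ↦ .fun_sum fun i hi ↦ ?_) L.isOpen_compl_lattice_sdiff
  split_ifs with h
  · simp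
  · refine .add (.add (.div (by fun_prop) (by fun_prop) fun x hx ↦ ?_) (by fun_prop)) (by fun_prop)
    have : x ≠ i := by rintro rfl; simp_all
    simpa [sub_eq_zero]

lemma deriv_weierstrassZetaExcept :
    Set.EqOn (deriv L.weierstrassZetaExcept) (fun z ↦ -L.weierstrassPExcept 0 z)
      (L.lattice \ {0})ᶜ := by
  have key (x : ℂ) (hx : x ∈ ((L.lattice : Set ℂ) \ {0})ᶜ) (l : L.lattice) :
      HasDerivAt (fun z : ℂ ↦
        if l.1 = 0 then 0 else (1 / (z - l) + 1 / (l : ℂ) + z / (l : ℂ) ^ 2))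
        (-(if l = (0 : ℂ) then 0 else (1 / (x - l) ^ 2 - 1 / (l : ℂ) ^ 2))) x := by
    split_ifs with h
    · simpa using hasDerivAt_const x (0 : ℂ)
    have hxl : x - l ≠ 0 := fun e ↦ by
      obtain rfl := sub_eq_zero.mp e
      simp_all
    have h1 : HasDerivAt (fun z : ℂ ↦ 1 / (z - l)) (-1 / (x - l) ^ 2) x := by
      simpa using (((hasDerivAt_id x).sub_const (l : ℂ)).fun_inv hxl)
    refine ((h1.add_const (1 / (l : ℂ))).add
      ((hasDerivAt_id x).div_const ((l : ℂ) ^ 2))).congr_deriv ?_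
    ring
  refine ((L.hasSumLocallyUniformly_weierstrassZetaExcept).tendstoLocallyUniformlyOn.deriv
    (.of_forall fun s ↦ ?_) L.isOpen_compl_lattice_sdiff).unique ?_
  · exact .fun_sum fun i hi x hx ↦ (key x hx i).differentiableAt.differentiableWithinAt
  · have h := (L.hasSumLocallyUniformly_weierstrassPExcept 0).tendstoLocallyUniformlyOn.mono
      (Set.subset_univ ((L.lattice : Set ℂ) \ {0})ᶜ)
    have h' : TendstoLocallyUniformlyOn
        (fun (s : Finset L.lattice) (z : ℂ) ↦
          -∑ l ∈ s, (if l = (0 : ℂ) then 0 else (1 / (z - l) ^ 2 - 1 / (l : ℂ) ^ 2)))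
        (fun z ↦ -L.weierstrassPExcept 0 z) atTop ((L.lattice : Set ℂ) \ {0})ᶜ := by
      simpa using! h.neg
    refine h'.congr ?_
    intro s x hx
    simp only [Function.comp_apply]
    rw [(HasDerivAt.fun_sum fun l _ ↦ key x hx l).deriv, Finset.sum_neg_distrib]

lemma hasDerivAt_weierstrassZetaExcept {z : ℂ} (hz : z ∈ ((L.lattice : Set ℂ) \ {0})ᶜ) :
    HasDerivAt L.weierstrassZetaExcept (-L.weierstrassPExcept 0 z) z := by
  exact (L.differentiableOn_weierstrassZetaExcept.differentiableAt
    (L.isOpen_compl_lattice_sdiff.mem_nhds hz)).hasDerivAt.congr_deriv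
    (L.deriv_weierstrassZetaExcept hz)

lemma weierstrassP_eq_except (z : ℂ) :
    L.weierstrassP z = 1 / z ^ 2 + L.weierstrassPExcept 0 z := by
  have := L.weierstrassPExcept_add 0 z
  simp at this
  rw [← this]; simp; ring

lemma hasDerivAt_weierstrassZeta {z : ℂ} (hz : z ∉ L.lattice) :
    HasDerivAt (DToda.weierstrassZeta L) (-L.weierstrassP z) z := by
  have hz0 : z ≠ 0 := by rintro rfl; simp at hz
  have h1 : HasDerivAt (fun z : ℂ ↦ 1 / z) (-1 / z ^ 2) z := by
    simpa using (hasDerivAt_id z).fun_inv hz0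
  have h2 := h1.add (L.hasDerivAt_weierstrassZetaExcept (z := z) (by simp [hz]))
  rw [show DToda.weierstrassZeta L = fun z ↦ 1 / z + L.weierstrassZetaExcept z from
    funext L.weierstrassZeta_eq, L.weierstrassP_eq_except]
  refine h2.congr_deriv ?_
  ring

lemma weierstrassZeta_neg (z : ℂ) :
    DToda.weierstrassZeta L (-z) = -DToda.weierstrassZeta L z := by
  simp only [DToda.weierstrassZeta]
  rw [← (Equiv.neg L.lattice).tsum_eq, ← tsum_neg]
  congr with l
  simp only [Equiv.neg_apply, NegMemClass.coe_neg, even_two, Even.neg_pow]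
  rw [show -z - -(l : ℂ) = -(z - l) by ring, div_neg, div_neg, neg_div]
  ring

lemma weierstrassZetaExcept_zero : L.weierstrassZetaExcept 0 = 0 := by
  have h := L.weierstrassZeta_eq 0
  have h2 := L.weierstrassZeta_neg 0
  rw [neg_zero, CharZero.eq_neg_self_iff] at h2
  simpa [h2] using h.symm

/-- Both sides have derivative -℘ on the complement of the lattice, which is connected because the
lattice is countable. -/
lemma exists_weierstrassZeta_add (l : ℂ) (hl : l ∈ L.lattice) :
    ∃ η : ℂ, ∀ z ∉ L.lattice, DToda.weierstrassZeta L (z + l) = DToda.weierstrassZeta L z + η := by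
  have hadd {z : ℂ} (hz : z ∈ (L.lattice : Set ℂ)ᶜ) : z + l ∉ L.lattice := fun h ↦
    hz (by simpa using sub_mem h hl)
  have hd1 {z : ℂ} (hz : z ∈ (L.lattice : Set ℂ)ᶜ) :
      HasDerivAt (fun z ↦ DToda.weierstrassZeta L (z + l)) (-L.weierstrassP z) z := by
    have := (L.hasDerivAt_weierstrassZeta (hadd hz)).comp_add_const z l
    rwa [L.weierstrassP_add_coe z ⟨l, hl⟩] at this
  have hd2 {z : ℂ} (hz : z ∈ (L.lattice : Set ℂ)ᶜ) := L.hasDerivAt_weierstrassZeta hz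
  obtain ⟨η, hη⟩ := L.isOpen_compl_lattice.exists_eq_add_of_deriv_eq
    L.isPreconnected_compl_lattice
    (fun z hz ↦ (hd1 hz).differentiableAt.differentiableWithinAt)
    (fun z hz ↦ (hd2 hz).differentiableAt.differentiableWithinAt)
    (fun z hz ↦ (hd1 hz).deriv.trans (hd2 hz).deriv.symm)
  exact ⟨η, fun z hz ↦ hη hz⟩

end PeriodPair

/-! ### Addition theorems for ζ. -/

namespace PeriodPair

variable (L : PeriodPair)

lemma hasDerivAt_weierstrassP {z : ℂ} (hz : z ∉ L.lattice) :
    HasDerivAt L.weierstrassP (L.derivWeierstrassP z) z := by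
  rw [← L.deriv_weierstrassP]
  exact (L.analyticOnNhd_weierstrassP z hz).differentiableAt.hasDerivAt

/-- The combination `ζ(a + z) - ζ(a) - ζ(z)`. -/
noncomputable def zetaDefect (z a : ℂ) : ℂ :=
  DToda.weierstrassZeta L (a + z) - DToda.weierstrassZeta L a - DToda.weierstrassZeta L z

lemma zetaDefect_comm (z a : ℂ) : L.zetaDefect z a = L.zetaDefect a z := by
  simp only [zetaDefect, add_comm z a]
  ring

lemma hasDerivAt_zetaDefect {z a : ℂ} (ha : a ∉ L.lattice) (haz : a + z ∉ L.lattice) :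
    HasDerivAt (L.zetaDefect z) (L.weierstrassP a - L.weierstrassP (a + z)) a := by
  refine ((((L.hasDerivAt_weierstrassZeta haz).comp_add_const a z).sub
    (L.hasDerivAt_weierstrassZeta ha)).sub_const _).congr_deriv ?_
  ring

/-- The difference of the two sides of the addition theorem for `ζ`. -/
noncomputable def zetaRelation (z a : ℂ) : ℂ :=
  L.zetaDefect z a ^ 2 - L.weierstrassP a - L.weierstrassP z - L.weierstrassP (a + z)

lemma hasDerivAt_zetaRelation {z a : ℂ} (ha : a ∉ L.lattice) (haz : a + z ∉ L.lattice) :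
    HasDerivAt (L.zetaRelation z)
      (2 * L.zetaDefect z a * (L.weierstrassP a - L.weierstrassP (a + z))
        - L.derivWeierstrassP a - L.derivWeierstrassP (a + z)) a := by
  refine (((((L.hasDerivAt_zetaDefect ha haz).pow 2).sub (L.hasDerivAt_weierstrassP ha)).sub_const
    _).sub ((L.hasDerivAt_weierstrassP haz).comp_add_const a z)).congr_deriv ?_
  simp

/-- Near 0 the defect is φ(a) - 1/a with φ(0) = 0 and φ'(0) = -℘(z). In its square, 1/a² cancels the
pole of ℘(a) and -2φ(a)/a tends to 2℘(z), which cancels the two remaining terms. -/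
lemma tendsto_zetaRelation {z : ℂ} (hz : z ∉ L.lattice) :
    Tendsto (L.zetaRelation z) (𝓝[≠] 0) (𝓝 0) := by
  set φ : ℂ → ℂ := fun a ↦ DToda.weierstrassZeta L (a + z) - L.weierstrassZetaExcept a
    - DToda.weierstrassZeta L z with hφ
  have hφ0 : φ 0 = 0 := by simp [hφ, weierstrassZetaExcept_zero]
  have h1 : HasDerivAt φ (-L.weierstrassP z) 0 := by
    have hz' : 0 + z ∉ L.lattice := by simpa using hz
    refine ((((L.hasDerivAt_weierstrassZeta hz').comp_add_const 0 z).sub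
      (L.hasDerivAt_weierstrassZetaExcept (z := 0) (by simp))).sub_const _).congr_deriv ?_
    simp
  have h2 := hasDerivAt_iff_tendsto_slope.mp h1
  have h3 : Tendsto φ (𝓝[≠] 0) (𝓝 0) := by
    simpa [hφ0] using h1.continuousAt.tendsto.mono_left nhdsWithin_le_nhds
  have h4 : Tendsto (L.weierstrassPExcept 0) (𝓝[≠] 0) (𝓝 0) := by
    simpa using
      (L.analyticAt_weierstrassPExcept 0).continuousAt.tendsto.mono_left nhdsWithin_le_nhds
  have h5 : Tendsto (fun a ↦ L.weierstrassP (a + z)) (𝓝[≠] 0) (𝓝 (L.weierstrassP z)) := by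
    have hz' : 0 + z ∉ L.lattice := by simpa using hz
    simpa using ((L.hasDerivAt_weierstrassP hz').comp_add_const 0 z).continuousAt.tendsto.mono_left
      nhdsWithin_le_nhds
  have h6 := ((((h3.pow 2).sub (h2.const_mul 2)).sub h4).sub_const (L.weierstrassP z)).sub h5
  refine (h6.congr' ?_).trans (by ring_nf; rfl)
  filter_upwards [self_mem_nhdsWithin] with a ha
  have ha : a ≠ 0 := ha
  simp only [zetaRelation, zetaDefect, slope_def_field, hφ, L.weierstrassP_eq_except a,
    L.weierstrassZeta_eq a, weierstrassZetaExcept_zero, zero_add]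
  field_simp
  ring

/-- The quasi-period η enters ζ(a + z) and ζ(a) equally and drops out of their difference. -/
lemma zetaRelation_add {z a l : ℂ} (ha : a ∉ L.lattice) (haz : a + z ∉ L.lattice)
    (hl : l ∈ L.lattice) : L.zetaRelation z (a + l) = L.zetaRelation z a := by
  obtain ⟨η, hη⟩ := L.exists_weierstrassZeta_add l hl
  have h1 := L.weierstrassP_add_coe a ⟨l, hl⟩
  have h2 := L.weierstrassP_add_coe (a + z) ⟨l, hl⟩
  simp only at h1 h2
  rw [zetaRelation, zetaRelation, zetaDefect, zetaDefect, show a + l + z = a + z + l by ring,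
    hη a ha, hη _ haz, h1, h2]
  ring

lemma zetaRelation_neg_sub (z a : ℂ) : L.zetaRelation z (-z - a) = L.zetaRelation z a := by
  rw [zetaRelation, zetaRelation, zetaDefect, zetaDefect, show -z - a + z = -a by ring,
    show -z - a = -(a + z) by ring]
  simp only [weierstrassZeta_neg, weierstrassP_neg]
  ring

-- Liouville: extended by 0 over its possible poles, the relation is continuous and doubly periodic,
-- hence constant. Translation reduces the poles to 0 and -z, and the symmetry a ↦ -z - a exchanges
-- these two.
open Classical in
lemma zetaRelation_eq_zero {z a : ℂ} (hz : z ∉ L.lattice) (ha : a ∉ L.lattice)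
    (haz : a + z ∉ L.lattice) : L.zetaRelation z a = 0 := by
  set S : Set ℂ := {a | a ∈ L.lattice ∨ a + z ∈ L.lattice} with hS
  have hSc : S.Countable := by
    refine L.countable_lattice.union (L.countable_lattice.preimage_of_injOn (f := (· + z)) ?_)
    exact (add_left_injective z).injOn
  have hSo : IsOpen Sᶜ := by
    have h := L.isOpen_compl_lattice
    convert! h.inter (h.preimage (continuous_add_const z)) using 1
    ext x; simp [hS]
  set E : ℂ → ℂ := fun a ↦ if a ∈ S then 0 else L.zetaRelation z a with hE
  have hEd (x : ℂ) (hx : x ∉ S) : DifferentiableAt ℂ E x := by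
    have hx' : x ∉ L.lattice ∧ x + z ∉ L.lattice := by simpa [hS] using hx
    refine (L.hasDerivAt_zetaRelation hx'.1 hx'.2).differentiableAt.congr_of_eventuallyEq ?_
    filter_upwards [hSo.mem_nhds hx] with y hy
    exact if_neg hy
  have hEp (x : ℂ) (l : ℂ) (hl : l ∈ L.lattice) : E (x + l) = E x := by
    have e1 : x + l ∈ L.lattice ↔ x ∈ L.lattice := L.lattice.add_mem_iff_left hl
    have e2 : x + l + z ∈ L.lattice ↔ x + z ∈ L.lattice := by
      rw [add_right_comm]; exact L.lattice.add_mem_iff_left hl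
    have e : x + l ∈ S ↔ x ∈ S := by simp [hS, e1, e2]
    by_cases hx : x ∈ S
    · simp [hE, e, hx]
    · simp only [hE, e, hx, if_false]
      simp only [hS, Set.mem_ofPred_eq, not_or] at hx
      exact L.zetaRelation_add hx.1 hx.2 hl
  have hEs (x : ℂ) : E (-z - x) = E x := by
    have e1 : -z - x ∈ L.lattice ↔ x + z ∈ L.lattice := by
      rw [← neg_mem_iff]; ring_nf
    have e2 : -z - x + z ∈ L.lattice ↔ x ∈ L.lattice := by
      rw [← neg_mem_iff]; ring_nf
    have e : -z - x ∈ S ↔ x ∈ S := by simp only [hS, Set.mem_ofPred_eq, e1, e2]; tauto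
    simp only [hE, e, zetaRelation_neg_sub]
  have hE0 : E 0 = 0 := by simp [hE, hS]
  have hEc0 : ContinuousAt E 0 := by
    rw [← continuousWithinAt_compl_self, ContinuousWithinAt, hE0]
    exact tendsto_const_nhds.if' (L.tendsto_zetaRelation hz)
  have hEcL {x : ℂ} (hx : x ∈ L.lattice) : ContinuousAt E x := by
    have h : ContinuousAt E (x - x) := by simpa using hEc0
    have h2 : ContinuousAt (E ∘ fun y ↦ y - x) x :=
      ContinuousAt.comp (f := fun y ↦ y - x) h (by fun_prop)
    convert! h2 using 1
    funext y
    simpa using hEp (y - x) x hx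
  have hEc : Continuous E := by
    rw [continuous_iff_continuousAt]
    intro x
    by_cases hx : x ∈ S
    · rcases hx with hx | hx
      · exact hEcL hx
      · have h : ContinuousAt E (-z - x) := hEcL (by
          rw [← neg_mem_iff]
          ring_nf
          simpa [add_comm] using hx)
        have h2 : ContinuousAt (E ∘ fun y ↦ -z - y) x :=
          ContinuousAt.comp (f := fun y ↦ -z - y) h (by fun_prop)
        convert! h2 using 1
        funext y
        exact (hEs y).symm
    · exact (hEd x hx).continuousAt
  have := L.apply_eq_apply_of_periodic hSc hEc hEd hEp a 0
  rw [hE0] at this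
  simpa [hE, hS, ha, haz] using this

/-- The addition theorem `(ζ(a + z) - ζ(a) - ζ(z))² = ℘(a) + ℘(z) + ℘(a + z)`. -/
lemma zetaDefect_sq {z a : ℂ} (hz : z ∉ L.lattice) (ha : a ∉ L.lattice)
    (haz : a + z ∉ L.lattice) :
    L.zetaDefect z a ^ 2 = L.weierstrassP a + L.weierstrassP z + L.weierstrassP (a + z) := by
  have h := L.zetaRelation_eq_zero hz ha haz
  rw [zetaRelation] at h
  linear_combination h

lemma zetaDefect_mul_sub_add {z a : ℂ} (hz : z ∉ L.lattice) (ha : a ∉ L.lattice)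
    (haz : a + z ∉ L.lattice) :
    2 * L.zetaDefect z a * (L.weierstrassP a - L.weierstrassP (a + z)) =
      L.derivWeierstrassP a + L.derivWeierstrassP (a + z) := by
  have h1 := L.hasDerivAt_zetaRelation ha haz
  have h2 : L.zetaRelation z =ᶠ[𝓝 a] fun _ ↦ 0 := by
    have h := L.isOpen_compl_lattice
    filter_upwards [h.mem_nhds ha, (h.preimage (continuous_add_const z)).mem_nhds haz]
      with x hx hxz using L.zetaRelation_eq_zero hz hx hxz
  have h3 := h1.unique ((hasDerivAt_const a (0 : ℂ)).congr_of_eventuallyEq h2)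
  linear_combination h3

/-- The addition theorem `2 (℘(a) - ℘(z)) (ζ(a + z) - ζ(a) - ζ(z)) = ℘'(a) - ℘'(z)`. -/
lemma zetaDefect_mul_sub {z a : ℂ} (hz : z ∉ L.lattice) (ha : a ∉ L.lattice)
    (haz : a + z ∉ L.lattice) :
    2 * L.zetaDefect z a * (L.weierstrassP a - L.weierstrassP z) =
      L.derivWeierstrassP a - L.derivWeierstrassP z := by
  have h1 := L.zetaDefect_mul_sub_add hz ha haz
  -- The same identity with a and z exchanged; subtracting eliminates the terms at a + z.
  have h2 := L.zetaDefect_mul_sub_add ha hz (by rwa [add_comm])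
  rw [L.zetaDefect_comm a z, add_comm z a] at h2
  linear_combination h1 - h2

end PeriodPair

/-! ### Values of ℘ and its second derivative. -/

namespace PeriodPair

variable (L : PeriodPair)

-- If ℘ omitted c, then 1/(℘ - c), set to 0 on the lattice, would be entire and doubly periodic,
-- hence identically 0; its value at a half period is nonzero.
open Classical in
lemma exists_weierstrassP_eq (c : ℂ) : ∃ z ∉ L.lattice, L.weierstrassP z = c := by
  by_contra! hne
  set f : ℂ → ℂ := fun x ↦ if x ∈ L.lattice then 0 else (L.weierstrassP x - c)⁻¹ with hf
  have hd (x : ℂ) (hx : x ∉ (L.lattice : Set ℂ)) : DifferentiableAt ℂ f x := by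
    refine (((L.hasDerivAt_weierstrassP hx).differentiableAt.sub_const c).inv
      (sub_ne_zero.mpr (hne x hx))).congr_of_eventuallyEq ?_
    filter_upwards [L.isOpen_compl_lattice.mem_nhds hx] with y hy
    exact if_neg hy
  have hp (x : ℂ) (l : ℂ) (hl : l ∈ L.lattice) : f (x + l) = f x := by
    have e1 : x + l ∈ L.lattice ↔ x ∈ L.lattice := L.lattice.add_mem_iff_left hl
    have e2 := L.weierstrassP_add_coe x ⟨l, hl⟩
    simp only at e2
    simp only [hf, e1, e2]
  have h0 : f 0 = 0 := by simp [hf]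
  have hc0 : ContinuousAt f 0 := by
    rw [← continuousWithinAt_compl_self, ContinuousWithinAt, h0]
    refine tendsto_const_nhds.if' ?_
    have h1 : ContinuousAt
        (fun x : ℂ ↦ x ^ 2 / (1 + x ^ 2 * (L.weierstrassPExcept 0 x - c))) 0 := by
      have := (L.analyticAt_weierstrassPExcept 0).continuousAt
      exact ContinuousAt.div (by fun_prop) (by fun_prop) (by simp)
    have h2 := h1.tendsto.mono_left (nhdsWithin_le_nhds (s := {0}ᶜ))
    simp only [ne_eq, OfNat.ofNat_ne_zero, not_false_eq_true, zero_pow, zero_div] at h2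
    refine h2.congr' ?_
    filter_upwards [self_mem_nhdsWithin] with x hx
    have hx : x ≠ 0 := hx
    rw [weierstrassP_eq_except, show 1 / x ^ 2 + L.weierstrassPExcept 0 x - c
      = (1 + x ^ 2 * (L.weierstrassPExcept 0 x - c)) / x ^ 2 by field_simp; ring, inv_div]
  have hc : Continuous f := by
    rw [continuous_iff_continuousAt]
    intro x
    by_cases hx : x ∈ L.lattice
    · have h : ContinuousAt f (x - x) := by simpa using hc0
      have h2 : ContinuousAt (f ∘ fun y ↦ y - x) x :=
        ContinuousAt.comp (f := fun y ↦ y - x) h (by fun_prop)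
      convert! h2 using 1
      funext y
      simpa using hp (y - x) x hx
    · exact (hd x hx).continuousAt
  have h := L.apply_eq_apply_of_periodic L.countable_lattice hc hd hp (L.ω₁ / 2) 0
  rw [h0] at h
  simp only [hf, L.ω₁_div_two_notMem_lattice, if_false, inv_eq_zero] at h
  exact hne _ L.ω₁_div_two_notMem_lattice (sub_eq_zero.mp h)

lemma not_forall_weierstrassP_eq (c : ℂ) : ¬ ∀ z ∈ (L.lattice : Set ℂ)ᶜ, L.weierstrassP z = c := by
  intro h
  obtain ⟨z, hz, hzc⟩ := L.exists_weierstrassP_eq (c + 1)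
  have := h z hz
  rw [hzc] at this
  simp at this

lemma not_forall_derivWeierstrassP_eq_zero :
    ¬ ∀ z ∈ (L.lattice : Set ℂ)ᶜ, L.derivWeierstrassP z = 0 := by
  intro h
  obtain ⟨c, hc⟩ := L.isOpen_compl_lattice.exists_is_const_of_deriv_eq_zero
    L.isPreconnected_compl_lattice L.differentiableOn_weierstrassP
    (fun z hz ↦ by rw [deriv_weierstrassP, h z hz]; rfl)
  exact L.not_forall_weierstrassP_eq c hc

/-- `℘'' = 6 ℘² - g₂ / 2`. -/
lemma deriv_derivWeierstrassP {z : ℂ} (hz : z ∉ L.lattice) :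
    deriv L.derivWeierstrassP z = 6 * L.weierstrassP z ^ 2 - L.g₂ / 2 := by
  have hP := L.analyticOnNhd_weierstrassP
  have hP' := L.analyticOnNhd_derivWeierstrassP
  have key (x : ℂ) (hx : x ∈ (L.lattice : Set ℂ)ᶜ) : L.derivWeierstrassP x *
      (deriv L.derivWeierstrassP x - (6 * L.weierstrassP x ^ 2 - L.g₂ / 2)) = 0 := by
    have h1 := L.hasDerivAt_weierstrassP hx
    have h2 : HasDerivAt L.derivWeierstrassP (deriv L.derivWeierstrassP x) x :=
      (hP' x hx).differentiableAt.hasDerivAt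
    have h3 := h2.pow 2
    have h4 := ((((h1.pow 3).const_mul 4).sub (h1.const_mul L.g₂)).sub_const L.g₃)
    have h5 := h3.unique (h4.congr_of_eventuallyEq (by
      filter_upwards [L.isOpen_compl_lattice.mem_nhds hx] with y hy
      exact L.derivWeierstrassP_sq y hy))
    norm_num at h5
    linear_combination h5 / 2
  have hA : AnalyticOnNhd ℂ (fun x ↦ deriv L.derivWeierstrassP x
      - (6 * L.weierstrassP x ^ 2 - L.g₂ / 2)) (L.lattice : Set ℂ)ᶜ := fun x hx ↦ by
    have h1 := hP x hx
    have h2 := (hP' x hx).deriv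
    fun_prop
  -- Differentiating the Weierstrass equation leaves a factor ℘', which may vanish at z; it is
  -- cancelled as an analytic function on a connected set.
  rcases AnalyticOnNhd.eq_zero_or_eq_zero_of_mul_eq_zero hP' hA key
    L.isPreconnected_compl_lattice with h | h
  · exact absurd h L.not_forall_derivWeierstrassP_eq_zero
  · exact sub_eq_zero.mp (h z hz)

lemma analyticAt_zetaDefect {z a : ℂ} (ha : a ∉ L.lattice) (haz : a + z ∉ L.lattice) :
    AnalyticAt ℂ (L.zetaDefect z) a := by
  have h := L.isOpen_compl_lattice
  rw [analyticAt_iff_eventually_differentiableAt]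
  filter_upwards [h.mem_nhds ha, (h.preimage (continuous_add_const z)).mem_nhds haz]
    with x hx hxz using (L.hasDerivAt_zetaDefect hx hxz).differentiableAt

/-- `℘` takes each value at most once up to sign and periods. -/
lemma add_mem_or_sub_mem_of_weierstrassP_eq {z a : ℂ} (hz : z ∉ L.lattice) (ha : a ∉ L.lattice)
    (h : L.weierstrassP a = L.weierstrassP z) : a + z ∈ L.lattice ∨ a - z ∈ L.lattice := by
  by_contra! hne
  have hz' : -z ∉ L.lattice := by simpa using hz
  have h1 := L.zetaDefect_mul_sub hz ha hne.1
  have h2 := L.zetaDefect_mul_sub hz' ha (by simpa [sub_eq_add_neg] using hne.2)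
  rw [weierstrassP_neg, derivWeierstrassP_neg, h] at h2
  rw [h] at h1
  have hz0 : L.derivWeierstrassP z = 0 := by linear_combination (h1 - h2) / 2
  set g : ℂ → ℂ := fun x ↦ L.weierstrassP x - L.weierstrassP z with hg
  have hgA : AnalyticAt ℂ g a := (L.analyticOnNhd_weierstrassP a ha).sub analyticAt_const
  have hga : g a = 0 := by simp [hg, h]
  have hFA : AnalyticAt ℂ (fun x ↦ 2 * L.zetaDefect z x) a :=
    analyticAt_const.mul (L.analyticAt_zetaDefect ha hne.1)
  -- As ℘'(z) = 0, the addition theorem becomes the linear equation g' = 2Wg with W analytic at a. A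
  -- zero of g of finite order would lose one order under differentiation, so g(a) = 0 forces g to
  -- vanish near a.
  have hode : deriv g =ᶠ[𝓝 a] (fun x ↦ 2 * L.zetaDefect z x) * g := by
    have ho := L.isOpen_compl_lattice
    filter_upwards [ho.mem_nhds ha, (ho.preimage (continuous_add_const z)).mem_nhds hne.1]
      with x hx hxz
    have := L.zetaDefect_mul_sub hz hx hxz
    rw [hz0, sub_zero] at this
    simp only [hg, Pi.mul_apply, this, deriv_sub_const]
    rw [deriv_weierstrassP]
  have hord := hgA.analyticOrderAt_deriv_add_one
  simp only [hga, sub_zero] at hord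
  rw [analyticOrderAt_congr hode, analyticOrderAt_mul hFA hgA] at hord
  have htop : analyticOrderAt g a = ⊤ := by
    by_contra hfin
    obtain ⟨n, hn⟩ := ENat.ne_top_iff_exists.mp hfin
    rw [← hn] at hord
    have h3 : ((n : ℕ∞) + 1) ≤ n := by
      conv_rhs => rw [← hord]
      gcongr
      exact le_add_self
    norm_cast at h3
    omega
  have hev := analyticOrderAt_eq_top.mp htop
  have hgL : AnalyticOnNhd ℂ g (L.lattice : Set ℂ)ᶜ :=
    fun x hx ↦ (L.analyticOnNhd_weierstrassP x hx).sub analyticAt_const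
  have hgz := hgL.eqOn_zero_of_preconnected_of_eventuallyEq_zero
    L.isPreconnected_compl_lattice ha hev
  exact L.not_forall_weierstrassP_eq _ fun x hx ↦ sub_eq_zero.mp (hgz hx)

end PeriodPair

/-! ### Level one modular forms: surjectivity of the j-invariant. -/

section LevelOne

open UpperHalfPlane ModularForm ModularFormClass MatrixGroups EisensteinSeries

lemma ModularForm.tendsto_atImInfty_qExpansion_coeff_zero {k : ℤ} (f : ModularForm 𝒮ℒ k) :
    Tendsto f atImInfty (𝓝 ((qExpansion 1 f).coeff 0)) := by
  have hanal := ModularFormClass.analyticAt_cuspFunction_zero f one_pos one_mem_strictPeriods_SL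
  have hper := SlashInvariantFormClass.periodic_comp_ofComplex f one_mem_strictPeriods_SL
  rw [qExpansion_coeff_zero one_pos hanal hper, ← cuspFunction_apply_zero one_pos hanal hper]
  exact (hanal.continuousAt.tendsto.comp (UpperHalfPlane.qParam_tendsto_atImInfty one_pos)).congr
    (fun τ ↦ SlashInvariantFormClass.eq_cuspFunction f τ one_mem_strictPeriods_SL one_ne_zero)

/-- A level one modular form of weight 12 that does not vanish at the cusp has a zero. -/
lemma ModularForm.exists_eq_zero_of_weight_twelve (f : ModularForm 𝒮ℒ 12)
    (hf : (qExpansion 1 f).coeff 0 ≠ 0) : ∃ τ : ℍ, f τ = 0 := by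
  -- Without zeros, Δ/f would be a form of weight 0, hence constant. It tends to 0 at the cusp,
  -- whereas Δ never vanishes.
  by_contra! hne
  have hslash (γ : SL(2, ℤ)) : (⇑CuspForm.discriminant / ⇑f) ∣[(12 : ℤ) - 12] γ =
      ⇑CuspForm.discriminant / ⇑f := by
    have hγ : (γ : GL (Fin 2) ℝ) ∈ 𝒮ℒ := ⟨γ, rfl⟩
    simp_rw [div_slash_SL2, SL_slash, SlashInvariantFormClass.slash_action_eq _ _ hγ]
  have hlim : Tendsto (⇑CuspForm.discriminant / ⇑f) atImInfty (𝓝 0) := by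
    have h := discriminant_isZeroAtImInfty.div f.tendsto_atImInfty_qExpansion_coeff_zero hf
    rwa [zero_div] at h
  let g : ModularForm 𝒮ℒ ((12 : ℤ) - 12) :=
    { toFun := ⇑CuspForm.discriminant / ⇑f
      slash_action_eq' := fun _ ⟨γ, hγ⟩ ↦ hγ ▸ hslash γ
      holo' := CuspForm.discriminant.holo'.div f.holo' hne
      bdd_at_cusps' {c} hc := by
        rw [Subgroup.IsArithmetic.isCusp_iff_isCusp_SL2Z] at hc
        rw [OnePoint.isBoundedAt_iff_forall_SL2Z hc]
        intro γ _
        rw [hslash γ]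
        exact hlim.isBigO_one ℝ }
  obtain ⟨c, hc⟩ := levelOne_weight_zero_const
    (ModularForm.mcast (by norm_num) g : ModularForm 𝒮ℒ 0)
  have hc' : ⇑CuspForm.discriminant / ⇑f = Function.const _ c := hc
  have hc0 : c = 0 := by
    rw [hc'] at hlim
    exact tendsto_nhds_unique tendsto_const_nhds hlim
  have h := congr_fun hc' I
  simp [hc0, hne, discriminant_ne_zero] at h

/-- This says that j/1728 takes the value c. The weight 12 form E₄³ - c(E₄³ - E₆²) has constant term
1, so it has a zero in the half plane. -/
lemma ModularForm.exists_E₄_cube_eq (c : ℂ) : ∃ τ : ℍ, E₄ τ ^ 3 = c * (E₄ τ ^ 3 - E₆ τ ^ 2) := by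
  let e : ModularForm 𝒮ℒ 12 := ModularForm.mcast (by decide) (E₄.pow 3)
  let e' : ModularForm 𝒮ℒ 12 := ModularForm.mcast (by decide) (E₆.pow 2)
  let f : ModularForm 𝒮ℒ 12 := e - c • (e - e')
  have hf (τ : ℍ) : f τ = E₄ τ ^ 3 - c * (E₄ τ ^ 3 - E₆ τ ^ 2) := rfl
  have hlim4 : Tendsto E₄ atImInfty (𝓝 1) := by
    have h := ModularForm.tendsto_atImInfty_qExpansion_coeff_zero E₄
    rwa [E_qExpansion_coeff_zero _ ⟨2, rfl⟩] at h
  have hlim6 : Tendsto E₆ atImInfty (𝓝 1) := by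
    have h := ModularForm.tendsto_atImInfty_qExpansion_coeff_zero E₆
    rwa [E_qExpansion_coeff_zero _ ⟨3, rfl⟩] at h
  have hlim := (hlim4.pow 3).sub (((hlim4.pow 3).sub (hlim6.pow 2)).const_mul c)
  have hq := tendsto_nhds_unique f.tendsto_atImInfty_qExpansion_coeff_zero hlim
  obtain ⟨τ, hτ⟩ := f.exists_eq_zero_of_weight_twelve (by rw [hq]; norm_num)
  exact ⟨τ, sub_eq_zero.mp hτ⟩

end LevelOne

/-! ### Lattices with prescribed invariants g₂ and g₃. -/

namespace PeriodPair

open UpperHalfPlane ModularForm EisensteinSeries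

/-- The pair of periods `(r τ, r)`. -/
noncomputable def ofUpperHalfPlane (r : ℂ) (hr : r ≠ 0) (τ : ℍ) : PeriodPair where
  ω₁ := r * τ
  ω₂ := r
  indep := by
    rw [LinearIndependent.pair_iff]
    intro s t h
    have h1 : (s : ℂ) * τ + t = 0 := by
      have : r * ((s : ℂ) * τ + t) = 0 := by
        simp only [real_smul] at h
        linear_combination h
      simpa [hr] using this
    have h2 := congrArg Complex.im h1
    simp [τ.im_ne_zero] at h2
    subst h2
    simpa using h1

lemma G_ofUpperHalfPlane (r : ℂ) (hr : r ≠ 0) (τ : ℍ) {k : ℕ} (hk : 3 ≤ k) :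
    (ofUpperHalfPlane r hr τ).G k = (r ^ k)⁻¹ * (2 * riemannZeta k * E hk τ) := by
  have hE : E hk τ = 1 / 2 * eisensteinSeries (N := 1) 0 k τ := rfl
  rw [hE, show 2 * riemannZeta k * (1 / 2 * eisensteinSeries (N := 1) 0 k τ) =
    riemannZeta k * eisensteinSeries (N := 1) 0 k τ by ring,
    ← tsum_eisSummand_eq_riemannZeta_mul_eisensteinSeries hk, ← tsum_mul_left, G,
    ← (ofUpperHalfPlane r hr τ).latticeEquivProd.symm.toEquiv.tsum_eq,
    ← (finTwoArrowEquiv ℤ).tsum_eq]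
  congr with v
  have h : ((ofUpperHalfPlane r hr τ).latticeEquivProd.symm.toEquiv (finTwoArrowEquiv ℤ v) : ℂ) =
      v 0 * (r * τ) + v 1 * r :=
    (ofUpperHalfPlane r hr τ).latticeEquiv_symm_apply (finTwoArrowEquiv ℤ v)
  rw [h, eisSummand, zpow_neg, zpow_natCast, ← mul_inv, ← mul_pow]
  congr 2
  ring

lemma riemannZeta_six : riemannZeta 6 = Real.pi ^ 6 / 945 := by
  have h := riemannZeta_two_mul_nat (k := 3) (by norm_num)
  have hb : bernoulli 6 = 1 / 42 := by decide +kernel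
  norm_num [hb, Nat.factorial] at h
  rw [h]
  ring

lemma g₂_ofUpperHalfPlane (r : ℂ) (hr : r ≠ 0) (τ : ℍ) :
    (ofUpperHalfPlane r hr τ).g₂ = (r ^ 4)⁻¹ * (4 * Real.pi ^ 4 / 3 * E₄ τ) := by
  have h := G_ofUpperHalfPlane r hr τ (k := 4) (by norm_num)
  have h4 := riemannZeta_four
  rw [g₂, h]
  push_cast
  rw [h4]
  ring

lemma g₃_ofUpperHalfPlane (r : ℂ) (hr : r ≠ 0) (τ : ℍ) :
    (ofUpperHalfPlane r hr τ).g₃ = (r ^ 6)⁻¹ * (8 * Real.pi ^ 6 / 27 * E₆ τ) := by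
  have h := G_ofUpperHalfPlane r hr τ (k := 6) (by norm_num)
  rw [g₃, h]
  push_cast
  rw [riemannZeta_six]
  ring

/-- If `(A : B)` and `(a : b)` have the same weighted homogeneous invariant, they differ by a
rescaling of weights `4` and `6`. -/
lemma exists_rescaling {A B a b : ℂ} (hAB : A ^ 3 - 27 * B ^ 2 ≠ 0) (hab : a ^ 3 - 27 * b ^ 2 ≠ 0)
    (h : A ^ 3 * b ^ 2 = B ^ 2 * a ^ 3) : ∃ r : ℂ, r ≠ 0 ∧ r ^ 4 * A = a ∧ r ^ 6 * B = b := by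
  by_cases ha : a = 0
  · subst ha
    have hb : b ≠ 0 := by rintro rfl; simp at hab
    have hA : A = 0 := by simpa [hb] using h
    subst hA
    have hB : B ≠ 0 := by rintro rfl; simp at hAB
    obtain ⟨r, hr⟩ := IsAlgClosed.exists_pow_nat_eq (b / B) (n := 6) (by norm_num)
    refine ⟨r, ?_, by simp, by rw [hr]; field_simp⟩
    rintro rfl
    exact div_ne_zero hb hB (by simpa using hr.symm)
  have hA : A ≠ 0 := by
    rintro rfl
    have hB : B = 0 := by simpa [ha] using h.symm
    simp [hB] at hAB
  by_cases hb : b = 0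
  · subst hb
    have hB : B = 0 := by simpa [ha] using h.symm
    obtain ⟨r, hr⟩ := IsAlgClosed.exists_pow_nat_eq (a / A) (n := 4) (by norm_num)
    refine ⟨r, ?_, by rw [hr]; field_simp, by simp [hB]⟩
    rintro rfl
    exact div_ne_zero ha hA (by simpa using hr.symm)
  have hB : B ≠ 0 := by
    rintro rfl
    simp [hA, hb] at h
  -- The two requirements force r² = r⁶/r⁴ = (b/B)/(a/A); the hypothesis `h` then makes r⁴ equal to
  -- a/A.
  obtain ⟨r, hr⟩ := IsAlgClosed.exists_pow_nat_eq (b * A / (B * a)) (n := 2) (by norm_num)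
  have hr2 : r ^ 4 = a / A := by
    rw [show r ^ 4 = (r ^ 2) ^ 2 by ring, hr]
    field_simp
    linear_combination h
  refine ⟨r, ?_, by rw [hr2]; field_simp, ?_⟩
  · rintro rfl
    exact div_ne_zero (mul_ne_zero hb hA) (mul_ne_zero hB ha) (by simpa using hr.symm)
  · rw [show r ^ 6 = r ^ 4 * r ^ 2 by ring, hr2, hr]
    field_simp

/-- Uniformization: every non-degenerate pair of invariants comes from a lattice. -/
lemma exists_g₂_g₃ {a b : ℂ} (hab : a ^ 3 - 27 * b ^ 2 ≠ 0) :
    ∃ L : PeriodPair, L.g₂ = a ∧ L.g₃ = b := by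
  obtain ⟨τ, hτ⟩ := ModularForm.exists_E₄_cube_eq (a ^ 3 / (a ^ 3 - 27 * b ^ 2))
  have hπ : (Real.pi : ℂ) ≠ 0 := by exact_mod_cast Real.pi_ne_zero
  have hΔ : E₄ τ ^ 3 - E₆ τ ^ 2 ≠ 0 := fun h ↦ discriminant_ne_zero τ (by
    rw [discriminant_eq_E₄_cube_sub_E₆_sq, h, zero_div])
  rw [div_mul_eq_mul_div, eq_div_iff hab] at hτ
  obtain ⟨r, hr, h4, h6⟩ := exists_rescaling (A := 4 * Real.pi ^ 4 / 3 * E₄ τ)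
    (B := 8 * Real.pi ^ 6 / 27 * E₆ τ) (a := a) (b := b)
    (by
      have : (4 * Real.pi ^ 4 / 3 * E₄ τ) ^ 3 - 27 * (8 * Real.pi ^ 6 / 27 * E₆ τ) ^ 2 =
        64 * (Real.pi : ℂ) ^ 12 / 27 * (E₄ τ ^ 3 - E₆ τ ^ 2) := by ring
      rw [this]
      exact mul_ne_zero (by simp [hπ]) hΔ) hab
    (by linear_combination (-64 * (Real.pi : ℂ) ^ 12 / 729) * hτ)
  refine ⟨ofUpperHalfPlane r⁻¹ (inv_ne_zero hr) τ, ?_, ?_⟩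
  · rw [g₂_ofUpperHalfPlane, ← h4]
    simp
  · rw [g₃_ofUpperHalfPlane, ← h6]
    simp

end PeriodPair

/-! ### The map's equations and first integral as identities between ℘ and ζ. -/

namespace PeriodPair

variable (L : PeriodPair)

lemma zetaDefect_sub (z a : ℂ) : L.zetaDefect z (a - z) = -L.zetaDefect (-z) a := by
  simp only [zetaDefect, weierstrassZeta_neg, sub_add_cancel, ← sub_eq_add_neg]
  ring

lemma two_mul_sub_mul_zetaDefect_sub {z a : ℂ} (hz : z ∉ L.lattice) (ha : a ∉ L.lattice)
    (haz : a - z ∉ L.lattice) :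
    2 * (L.weierstrassP z - L.weierstrassP a) * L.zetaDefect z (a - z) =
      L.derivWeierstrassP a + L.derivWeierstrassP z := by
  have h := L.zetaDefect_mul_sub (z := -z) (by simpa using hz) ha (by rwa [← sub_eq_add_neg])
  rw [weierstrassP_neg, derivWeierstrassP_neg] at h
  rw [zetaDefect_sub]
  linear_combination h

lemma zetaDefect_add_zetaDefect_sub {z a : ℂ} (hz : z ∉ L.lattice) (ha : a ∉ L.lattice)
    (haz : a - z ∉ L.lattice) (haz' : a + z ∉ L.lattice) :
    (L.zetaDefect z a + L.zetaDefect z (a - z)) * (L.weierstrassP z - L.weierstrassP a) =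
      L.derivWeierstrassP z := by
  linear_combination (L.two_mul_sub_mul_zetaDefect_sub hz ha haz -
    L.zetaDefect_mul_sub hz ha haz') / 2

lemma sub_add_sub_eq_zetaDefect {z a : ℂ} (hz : z ∉ L.lattice) (ha : a ∉ L.lattice)
    (haz : a + z ∉ L.lattice) :
    (L.weierstrassP z - L.weierstrassP a) + (L.weierstrassP z - L.weierstrassP (a + z)) =
      -L.zetaDefect z a ^ 2 + 3 * L.weierstrassP z := by
  linear_combination L.zetaDefect_sq hz ha haz

/-- This evaluates H. After multiplication by ℘(z) - ℘(a) it follows from the Weierstrass equations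
at a and z. The factor vanishes at a = -z, a case needed when d = 0, so it is cancelled by the
identity theorem. -/
lemma zetaDefect_cubic {z a : ℂ} (hz : z ∉ L.lattice) (ha : a ∉ L.lattice)
    (haz : a - z ∉ L.lattice) :
    (L.weierstrassP z - L.weierstrassP a) * (L.zetaDefect z (a - z) ^ 2
      + (L.weierstrassP z - L.weierstrassP a) - 3 * L.weierstrassP z)
      - L.derivWeierstrassP z * L.zetaDefect z (a - z) =
    -3 * L.weierstrassP z ^ 2 + L.g₂ / 4 := by
  set U : Set ℂ := ((L.lattice : Set ℂ) ∪ {x | x - z ∈ L.lattice})ᶜ with hU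
  have hmem {x : ℂ} (hx : x ∈ U) : x ∉ L.lattice ∧ x - z ∉ L.lattice := by simpa [hU] using hx
  have hUc : IsPreconnected U := by
    refine (Set.Countable.isConnected_compl_of_one_lt_rank (by simp)
      (L.countable_lattice.union ?_)).2
    exact L.countable_lattice.preimage_of_injOn (f := (· - z)) sub_left_injective.injOn
  have hA1 : AnalyticOnNhd ℂ (fun x ↦ L.weierstrassP z - L.weierstrassP x) U := fun x hx ↦
    analyticAt_const.sub (L.analyticOnNhd_weierstrassP x (hmem hx).1)
  have hW : AnalyticOnNhd ℂ (fun x ↦ L.zetaDefect z (x - z)) U := fun x hx ↦ by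
    have h1 : AnalyticAt ℂ (L.zetaDefect z) (x - z) :=
      L.analyticAt_zetaDefect (hmem hx).2 (by simpa using (hmem hx).1)
    exact h1.comp (f := fun x ↦ x - z) (by fun_prop)
  have hA2 : AnalyticOnNhd ℂ (fun x ↦ (L.weierstrassP z - L.weierstrassP x) *
      (L.zetaDefect z (x - z) ^ 2 + (L.weierstrassP z - L.weierstrassP x) - 3 * L.weierstrassP z)
      - L.derivWeierstrassP z * L.zetaDefect z (x - z)
      - (-3 * L.weierstrassP z ^ 2 + L.g₂ / 4)) U := fun x hx ↦ by
    have h1 := hA1 x hx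
    have h2 := hW x hx
    exact ((h1.mul (((h2.pow 2).add h1).sub analyticAt_const)).sub
      (analyticAt_const.mul h2)).sub analyticAt_const
  have hmul (x : ℂ) (hx : x ∈ U) : (L.weierstrassP z - L.weierstrassP x) *
      ((L.weierstrassP z - L.weierstrassP x) *
      (L.zetaDefect z (x - z) ^ 2 + (L.weierstrassP z - L.weierstrassP x) - 3 * L.weierstrassP z)
      - L.derivWeierstrassP z * L.zetaDefect z (x - z)
      - (-3 * L.weierstrassP z ^ 2 + L.g₂ / 4)) = 0 := by
    have h1 := L.two_mul_sub_mul_zetaDefect_sub hz (hmem hx).1 (hmem hx).2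
    have h2 := L.derivWeierstrassP_sq x (hmem hx).1
    have h3 := L.derivWeierstrassP_sq z hz
    linear_combination (2 * (L.weierstrassP z - L.weierstrassP x) * L.zetaDefect z (x - z) +
      L.derivWeierstrassP x + L.derivWeierstrassP z) / 4 * h1
      - L.derivWeierstrassP z / 2 * h1 + h2 / 4 - h3 / 4
  rcases AnalyticOnNhd.eq_zero_or_eq_zero_of_mul_eq_zero hA1 hA2 hmul hUc with h | h
  · have hP : AnalyticOnNhd ℂ (fun x ↦ L.weierstrassP z - L.weierstrassP x)
        (L.lattice : Set ℂ)ᶜ := fun x hx ↦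
      analyticAt_const.sub (L.analyticOnNhd_weierstrassP x hx)
    have haU : U ∈ 𝓝 a := by
      have ho := L.isOpen_compl_lattice
      filter_upwards [ho.mem_nhds ha,
        (ho.preimage (continuous_sub_right z)).mem_nhds haz] with x hx hxz
      simp only [hU, Set.mem_compl_iff, Set.mem_union, not_or]
      exact ⟨hx, hxz⟩
    have h0 := hP.eqOn_zero_of_preconnected_of_eventuallyEq_zero L.isPreconnected_compl_lattice ha
      (by filter_upwards [haU] with x hx using h x hx)
    exact absurd (fun x hx ↦ (sub_eq_zero.mp (h0 hx)).symm) (L.not_forall_weierstrassP_eq _)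
  · refine sub_eq_zero.mp (h a ?_)
    simp only [hU, Set.mem_compl_iff, Set.mem_union, not_or]
    exact ⟨ha, haz⟩

lemma weierstrassP_eq_of_sub_mem {a z : ℂ} (h : a - z ∈ L.lattice) :
    L.weierstrassP a = L.weierstrassP z := by
  have := L.weierstrassP_add_coe z ⟨a - z, h⟩
  simpa using this

lemma weierstrassP_eq_of_add_mem {a z : ℂ} (h : a + z ∈ L.lattice) :
    L.weierstrassP a = L.weierstrassP z := by
  rw [← L.weierstrassP_neg z]
  exact L.weierstrassP_eq_of_sub_mem (by simpa using h)

/-- Every point of the cubic `y² = 4 x³ - g₂ x - g₃` is of the form `(℘(z), ℘'(z))`. -/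
lemma exists_weierstrassP_eq_and_derivWeierstrassP_eq {x y : ℂ}
    (h : y ^ 2 = 4 * x ^ 3 - L.g₂ * x - L.g₃) :
    ∃ z ∉ L.lattice, L.weierstrassP z = x ∧ L.derivWeierstrassP z = y := by
  obtain ⟨z, hz, hzx⟩ := L.exists_weierstrassP_eq x
  have h2 := L.derivWeierstrassP_sq z hz
  rw [hzx, ← h, sq_eq_sq_iff_eq_or_eq_neg] at h2
  rcases h2 with h2 | h2
  · exact ⟨z, hz, hzx, h2⟩
  · exact ⟨-z, by simpa using hz, by simpa using hzx, by simp [h2]⟩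

end PeriodPair

/-! ### The map, its first integral, and the parametrization of orbits. -/

namespace DToda

lemma ellipticV_eq (ε : ℂ) (L : PeriodPair) (z₀ z : ℂ) (n : ℤ) :
    ellipticV ε L z₀ z n = ε * L.zetaDefect z (z₀ + n * z) := by
  rw [ellipticV, PeriodPair.zetaDefect]
  ring_nf

lemma ellipticV_sub_one (ε : ℂ) (L : PeriodPair) (z₀ z : ℂ) (n : ℤ) :
    ellipticV ε L z₀ z (n - 1) = ε * L.zetaDefect z (z₀ + n * z - z) := by
  rw [ellipticV_eq]
  push_cast
  ring_nf

lemma hasFDerivAt_H (u f : ℂ) (p : ℂ × ℂ) :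
    HasFDerivAt (H u f) ((2 * p.2 * p.1 - u) • ContinuousLinearMap.fst ℂ ℂ ℂ +
      (p.1 ^ 2 + 2 * p.2 + f) • ContinuousLinearMap.snd ℂ ℂ ℂ) p := by
  have h1 : HasFDerivAt (fun p : ℂ × ℂ ↦ p.1) (ContinuousLinearMap.fst ℂ ℂ ℂ) p := hasFDerivAt_fst
  have h2 : HasFDerivAt (fun p : ℂ × ℂ ↦ p.2) (ContinuousLinearMap.snd ℂ ℂ ℂ) p := hasFDerivAt_snd
  refine ((h2.mul (((h1.pow 2).add h2).add_const f)).sub (h1.const_mul u)).congr_fderiv ?_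
  ext <;> simp <;> ring

lemma fderiv_H_eq_zero_iff (u f : ℂ) (p : ℂ × ℂ) :
    fderiv ℂ (H u f) p = 0 ↔ 2 * p.2 * p.1 - u = 0 ∧ p.1 ^ 2 + 2 * p.2 + f = 0 := by
  rw [(hasFDerivAt_H u f p).fderiv]
  constructor
  · intro h
    have h1 := DFunLike.congr_fun h (1, 0)
    have h2 := DFunLike.congr_fun h (0, 1)
    simp only [add_apply, smul_apply, ContinuousLinearMap.coe_fst',
      ContinuousLinearMap.coe_snd', smul_eq_mul, mul_one, mul_zero, add_zero, zero_add,
      zero_apply] at h1 h2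
    exact ⟨h1, h2⟩
  · rintro ⟨h1, h2⟩
    ext <;> simp [h1, h2]

open Polynomial in
lemma finite_fderiv_H_eq_zero (u f : ℂ) : {p : ℂ × ℂ | fderiv ℂ (H u f) p = 0}.Finite := by
  set P : ℂ[X] := X ^ 3 + C f * X + C u with hP
  have hP0 : P ≠ 0 := by
    intro h
    have := congrArg (coeff · 3) h
    simp [hP] at this
  refine (P.roots.toFinset.finite_toSet.image fun v ↦ (v, -(v ^ 2 + f) / 2)).subset ?_
  intro p hp
  obtain ⟨h1, h2⟩ := (fderiv_H_eq_zero_iff u f p).mp hp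
  refine ⟨p.1, Finset.mem_coe.mpr (Multiset.mem_toFinset.mpr ((mem_roots hP0).mpr ?_)),
    Prod.ext rfl ?_⟩
  · simp only [IsRoot.def, hP, eval_add, eval_mul, eval_pow, eval_X, eval_C]
    linear_combination p.1 * h2 - h1
  · simp only
    linear_combination -h2 / 2

/-- H is quadratic in v and in d separately. The map replaces v by the other root of H = const for
fixed d, then d by the other root for the new v. -/
lemma H_map (u f : ℂ) (p : ℂ × ℂ) (hp : p.2 ≠ 0) : H u f (map u f p) = H u f p := by
  simp only [H, map]
  field_simp
  ring

lemma hasFDerivAt_map (u f : ℂ) (p : ℂ × ℂ) (hp : p.2 ≠ 0) :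
    HasFDerivAt (map u f)
      ((-ContinuousLinearMap.fst ℂ ℂ ℂ - (u / p.2 ^ 2) • ContinuousLinearMap.snd ℂ ℂ ℂ).prod
        (-ContinuousLinearMap.snd ℂ ℂ ℂ - (2 * (-p.1 + u / p.2)) •
          (-ContinuousLinearMap.fst ℂ ℂ ℂ - (u / p.2 ^ 2) • ContinuousLinearMap.snd ℂ ℂ ℂ))) p := by
  have h1 : HasFDerivAt (fun p : ℂ × ℂ ↦ p.1) (ContinuousLinearMap.fst ℂ ℂ ℂ) p := hasFDerivAt_fst
  have h2 : HasFDerivAt (fun p : ℂ × ℂ ↦ p.2) (ContinuousLinearMap.snd ℂ ℂ ℂ) p := hasFDerivAt_snd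
  have hdiv : HasDerivAt (fun y : ℂ ↦ u / y) (-u / p.2 ^ 2) p.2 := by
    simpa using (hasDerivAt_const p.2 u).fun_div (hasDerivAt_id p.2) hp
  have h3 : HasFDerivAt (fun p : ℂ × ℂ ↦ -p.1 + u / p.2)
      (-ContinuousLinearMap.fst ℂ ℂ ℂ - (u / p.2 ^ 2) • ContinuousLinearMap.snd ℂ ℂ ℂ) p := by
    refine (h1.neg.add (hdiv.comp_hasFDerivAt p h2)).congr_fderiv ?_
    ext <;> simp [neg_div]
  refine (h3.prodMk ((h2.neg.sub (h3.pow 2)).sub_const f)).congr_fderiv ?_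
  ext <;> simp <;> ring_nf <;> simp

lemma symplecticForm_apply (w : Fin 2 → ℂ × ℂ) :
    symplecticForm w = (w 0).1 * (w 1).2 - (w 1).1 * (w 0).2 := rfl

/-- Modulo dv_n, dd_{n+1} is -dd_n; modulo dd_n, dv_n is -dv_{n-1}. The two signs cancel. -/
lemma symplecticForm_compContinuousLinearMap_fderiv_map (u f : ℂ) (p : ℂ × ℂ) (hp : p.2 ≠ 0) :
    symplecticForm.compContinuousLinearMap (fderiv ℂ (map u f) p) = symplecticForm := by
  rw [(hasFDerivAt_map u f p hp).fderiv]
  ext w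
  rw [ContinuousAlternatingMap.compContinuousLinearMap_apply, symplecticForm_apply,
    symplecticForm_apply]
  simp
  ring

lemma deriv_deriv_weierstrassP (L : PeriodPair) {z : ℂ} (hz : z ∉ L.lattice) :
    -(1 / 2) * deriv (deriv L.weierstrassP) z = -3 * L.weierstrassP z ^ 2 + L.g₂ / 4 := by
  rw [L.deriv_weierstrassP, L.deriv_derivWeierstrassP hz]
  ring

lemma isSolutionOn_elliptic {L : PeriodPair} {z₀ z ε : ℂ} {I : Set ℤ} (hε : ε = 1 ∨ ε = -1)
    (h : AvoidsPoles L z₀ z I) :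
    IsSolutionOn (ε * deriv L.weierstrassP z) (-3 * L.weierstrassP z) I
      (ellipticV ε L z₀ z) (ellipticD L z₀ z) := by
  have hε2 : ε ^ 2 = 1 := by rcases hε with rfl | rfl <;> norm_num
  obtain ⟨hz, h⟩ := h
  intro n hn hn1
  have ha : z₀ + n * z ∉ L.lattice := (h n hn).2
  have ham : z₀ + n * z - z ∉ L.lattice := by
    have := (h n hn).1
    rwa [show z₀ + ((n : ℂ) - 1) * z = z₀ + n * z - z by ring] at this
  have hap : z₀ + n * z + z ∉ L.lattice := by
    have := (h _ hn1).2
    push_cast at this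
    rwa [show z₀ + ((n : ℂ) + 1) * z = z₀ + n * z + z by ring] at this
  have hd : ellipticD L z₀ z n ≠ 0 := fun h0 ↦ by
    rcases L.add_mem_or_sub_mem_of_weierstrassP_eq hz ha (sub_eq_zero.mp h0).symm with h1 | h1
    exacts [hap h1, ham h1]
  refine ⟨hd, ?_, ?_⟩
  · rw [ellipticV_eq, ellipticV_sub_one, L.deriv_weierstrassP]
    have h1 := L.zetaDefect_add_zetaDefect_sub hz ha ham hap
    field_simp
    rw [ellipticD]
    linear_combination ε * h1
  · have h1 := L.sub_add_sub_eq_zetaDefect hz ha hap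
    rw [ellipticV_eq, ellipticD, ellipticD, mul_pow, hε2]
    push_cast
    rw [show z₀ + ((n : ℂ) + 1) * z = z₀ + n * z + z by ring]
    linear_combination h1

lemma H_elliptic {L : PeriodPair} {z₀ z ε : ℂ} {I : Set ℤ} (hε : ε = 1 ∨ ε = -1)
    (h : AvoidsPoles L z₀ z I) (n : ℤ) (hn : n ∈ I) :
    H (ε * deriv L.weierstrassP z) (-3 * L.weierstrassP z)
      (ellipticV ε L z₀ z (n - 1), ellipticD L z₀ z n)
      = -(1 / 2) * deriv (deriv L.weierstrassP) z := by
  have hε2 : ε ^ 2 = 1 := by rcases hε with rfl | rfl <;> norm_num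
  obtain ⟨hz, h⟩ := h
  have ham : z₀ + n * z - z ∉ L.lattice := by
    have := (h n hn).1
    rwa [show z₀ + ((n : ℂ) - 1) * z = z₀ + n * z - z by ring] at this
  rw [deriv_deriv_weierstrassP L hz, ← L.zetaDefect_cubic hz (h n hn).2 ham, H, ellipticV_sub_one,
    ellipticD, L.deriv_weierstrassP]
  simp only
  linear_combination ((L.weierstrassP z - L.weierstrassP (z₀ + n * z)) *
    L.zetaDefect z (z₀ + n * z - z) ^ 2 -
    L.derivWeierstrassP z * L.zetaDefect z (z₀ + n * z - z)) * hε2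

/-- On a nonsingular level set, the associated Weierstrass cubic is nonsingular. -/
lemma IsNonsingularLevel.discriminant_ne_zero {u f h : ℂ} (hns : IsNonsingularLevel u f h) :
    (4 * f ^ 2 / 3 + 4 * h) ^ 3 -
      27 * (-4 * f ^ 3 / 27 + (4 * f ^ 2 / 3 + 4 * h) * f / 3 - u ^ 2) ^ 2 ≠ 0 := by
  intro h0
  have hcrit (v d : ℂ) (hH : H u f (v, d) = h) (h1 : 2 * d * v - u = 0)
      (h2 : v ^ 2 + 2 * d + f = 0) : False :=
    hns (v, d) hH ((fderiv_H_eq_zero_iff u f (v, d)).mpr ⟨h1, h2⟩)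
  obtain ⟨a, ha⟩ : ∃ a, a = 4 * f ^ 2 / 3 + 4 * h := ⟨_, rfl⟩
  obtain ⟨b, hb⟩ : ∃ b, b = -4 * f ^ 3 / 27 + a * f / 3 - u ^ 2 := ⟨_, rfl⟩
  rw [← ha, ← hb] at h0
  -- Zero discriminant means that the cubic is 4(X - e)²(X + 2e). Its singular point (e, 0)
  -- corresponds to d = -f/3 - e, 2vd = u; if this d is 0, then u = 0 and (s, 0) with s² = -f is
  -- critical.
  obtain ⟨e, hea, heb⟩ : ∃ e : ℂ, a = 12 * e ^ 2 ∧ b = -8 * e ^ 3 := by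
    by_cases ha0 : a = 0
    · subst ha0
      exact ⟨0, by simp, by simpa using h0⟩
    · refine ⟨-(3 * b) / (2 * a), ?_, ?_⟩
      · field_simp
        linear_combination h0 * 4
      · field_simp
        linear_combination 8 * b * h0
  have hh : h = 3 * e ^ 2 - f ^ 2 / 3 := by linear_combination (hea - ha) / 4
  have hu : u ^ 2 = 4 * (-f / 3 - e) ^ 2 * (-f / 3 + 2 * e) := by
    linear_combination hb - heb + f / 3 * hea
  by_cases hX : -f / 3 - e = 0
  · obtain ⟨s, hs⟩ := IsAlgClosed.exists_pow_nat_eq (-f) (n := 2) (by norm_num)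
    have hu0 : u = 0 := by simpa [hX] using hu
    have hf : e = -f / 3 := by linear_combination -hX
    refine hcrit s 0 ?_ (by simp [hu0]) (by simp [hs])
    simp only [H, hu0, hh, hf]
    ring
  · obtain ⟨d, hd⟩ : ∃ d, d = -f / 3 - e := ⟨_, rfl⟩
    rw [← hd] at hX hu
    have he : e = -f / 3 - d := by linear_combination hd
    have hv : (u / (2 * d)) ^ 2 = -f / 3 + 2 * e := by
      rw [div_pow, hu]
      field_simp
      ring
    have hv' : u / (2 * d) * (2 * d) = u := div_mul_cancel₀ _ (by simpa using hX)
    refine hcrit (u / (2 * d)) d ?_ (by linear_combination hv') ?_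
    · simp only [H]
      rw [hh, he]
      rw [he] at hv
      linear_combination (-d) * hv + (u / (2 * d)) * hv'
    · rw [hv, he]
      ring

/-- A solution of the map that agrees with the elliptic formulas at one index does so throughout. -/
lemma elliptic_of_elliptic_at {L : PeriodPair} {z₀ z ε u f : ℂ} {I : Set ℤ} {v d : ℤ → ℂ} {n₀ : ℤ}
    (hε : ε = 1 ∨ ε = -1) (hI : I.OrdConnected) (hsol : IsSolutionOn u f I v d) (hn₀ : n₀ ∈ I)
    (hz : z ∉ L.lattice) (hu : u = ε * L.derivWeierstrassP z) (hf : f = -3 * L.weierstrassP z)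
    (h₀ : z₀ + n₀ * z - z ∉ L.lattice ∧ z₀ + n₀ * z ∉ L.lattice ∧
      v (n₀ - 1) = ε * L.zetaDefect z (z₀ + n₀ * z - z) ∧ d n₀ = ellipticD L z₀ z n₀)
    (n : ℤ) (hn : n ∈ I) :
    z₀ + n * z - z ∉ L.lattice ∧ z₀ + n * z ∉ L.lattice ∧
      v (n - 1) = ε * L.zetaDefect z (z₀ + n * z - z) ∧ d n = ellipticD L z₀ z n := by
  have hε2 : ε ^ 2 = 1 := by rcases hε with rfl | rfl <;> norm_num
  rcases le_total n₀ n with hle | hle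
  · induction n, hle using Int.leInduction with
    | base => exact h₀
    | succ n hle ih =>
      have hnI : n ∈ I := hI.out hn₀ hn ⟨hle, by omega⟩
      obtain ⟨ham, ha, hv, hd⟩ := ih hnI
      obtain ⟨hd0, hv1, hd1⟩ := hsol n hnI hn
      -- The condition d_n ≠ 0, part of being a solution, is what keeps the next argument off the
      -- poles.
      have hap : z₀ + n * z + z ∉ L.lattice := fun hmem ↦ hd0 (by
        rw [hd, ellipticD, L.weierstrassP_eq_of_add_mem hmem, sub_self])
      have hvn : v n = ε * L.zetaDefect z (z₀ + n * z) := by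
        have h1 := L.zetaDefect_add_zetaDefect_sub hz ha ham hap
        rw [hv1, hv, hu]
        field_simp
        rw [hd, ellipticD]
        linear_combination -ε * h1
      have h2 := L.sub_add_sub_eq_zetaDefect hz ha hap
      push_cast
      rw [ellipticD, show z₀ + ((n : ℂ) + 1) * z - z = z₀ + n * z by ring, add_sub_cancel_right]
      push_cast
      rw [show z₀ + ((n : ℂ) + 1) * z = z₀ + n * z + z by ring]
      refine ⟨ha, hap, hvn, ?_⟩
      rw [hd1, hd, hvn, hf, mul_pow, hε2, ellipticD]
      linear_combination -h2
  · induction n, hle using Int.leInductionDown with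
    | base => exact h₀
    | pred n hle ih =>
      have hnI : n ∈ I := hI.out hn hn₀ ⟨by omega, hle⟩
      obtain ⟨ham, ha, hv, hd⟩ := ih hnI
      obtain ⟨m, rfl⟩ : ∃ m, n = m + 1 := ⟨n - 1, by ring⟩
      simp only [add_sub_cancel_right] at hn hv ⊢
      push_cast at ham ha hv
      rw [ellipticD] at hd
      push_cast at hd
      rw [show z₀ + ((m : ℂ) + 1) * z - z = z₀ + m * z by ring] at ham hv
      rw [show z₀ + ((m : ℂ) + 1) * z = z₀ + m * z + z by ring] at ha hd
      obtain ⟨hd0, hv1, hd1⟩ := hsol m hn hnI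
      have h2 := L.sub_add_sub_eq_zetaDefect hz ham ha
      have hdm : d m = L.weierstrassP z - L.weierstrassP (z₀ + m * z) := by
        rw [hd, hv, hf, mul_pow, hε2] at hd1
        linear_combination hd1 - h2
      have hamm : z₀ + m * z - z ∉ L.lattice := fun hmem ↦ hd0 (by
        rw [hdm, L.weierstrassP_eq_of_sub_mem hmem, sub_self])
      refine ⟨hamm, ham, ?_, hdm⟩
      have h1 := L.zetaDefect_add_zetaDefect_sub hz ham hamm ha
      have h3 : v (m - 1) = -v m + u / d m := by rw [hv1]; ring
      rw [h3, hv, hu]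
      field_simp
      rw [hdm]
      linear_combination -ε * h1

lemma exists_elliptic {u f h ε : ℂ} {I : Set ℤ} {v d : ℤ → ℂ} {n₀ : ℤ} (hε : ε = 1 ∨ ε = -1)
    (hns : IsNonsingularLevel u f h) (hI : I.OrdConnected) (hsol : IsSolutionOn u f I v d)
    (hn₀ : n₀ ∈ I) (hH : H u f (v (n₀ - 1), d n₀) = h) :
    ∃ (L : PeriodPair) (z₀ z : ℂ),
      AvoidsPoles L z₀ z I ∧
      u = ε * deriv L.weierstrassP z ∧
      f = -3 * L.weierstrassP z ∧
      h = -(1 / 2) * deriv (deriv L.weierstrassP) z ∧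
      ∀ n ∈ I, v (n - 1) = ellipticV ε L z₀ z (n - 1) ∧ d n = ellipticD L z₀ z n := by
  have hε2 : ε ^ 2 = 1 := by rcases hε with rfl | rfl <;> norm_num
  obtain ⟨L, hg2, hg3⟩ := PeriodPair.exists_g₂_g₃ hns.discriminant_ne_zero
  obtain ⟨z, hz, hPz, hP'z⟩ := L.exists_weierstrassP_eq_and_derivWeierstrassP_eq
    (x := -f / 3) (y := ε * u) (by rw [hg2, hg3, mul_pow, hε2]; ring)
  have hu : u = ε * L.derivWeierstrassP z := by
    rw [hP'z]
    linear_combination -u * hε2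
  have hf : f = -3 * L.weierstrassP z := by rw [hPz]; ring
  have hh : h = -3 * L.weierstrassP z ^ 2 + L.g₂ / 4 := by rw [hPz, hg2]; ring
  obtain ⟨a, ha, ham, hPa, hWa⟩ : ∃ a ∉ L.lattice, a - z ∉ L.lattice ∧
      L.weierstrassP z - L.weierstrassP a = d n₀ ∧ ε * L.zetaDefect z (a - z) = v (n₀ - 1) := by
    generalize v (n₀ - 1) = v at hH
    generalize d n₀ = d at hH
    simp only [H] at hH
    -- For d = 0 the cubic point does not determine v. Here u ≠ 0, as otherwise the level is
    -- singular, so v is recovered from -uv = h. The choice a = -z, not z, keeps a - z off the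
    -- lattice.
    by_cases hd : d = 0
    · subst hd
      have hu0 : u ≠ 0 := by
        rintro rfl
        obtain ⟨s, hs⟩ := IsAlgClosed.exists_pow_nat_eq (-f) (n := 2) (by norm_num)
        refine hns (s, 0) ?_ ((fderiv_H_eq_zero_iff 0 f (s, 0)).mpr ⟨by simp, by simp [hs]⟩)
        simpa [H] using hH
      have hP'0 : L.derivWeierstrassP z ≠ 0 := fun h0 ↦ hu0 (by rw [hu, h0, mul_zero])
      have hz' : -z ∉ L.lattice := by simpa using hz
      have hzz : -z - z ∉ L.lattice := fun hmem ↦ hP'0 (by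
        have h1 := L.derivWeierstrassP_add_coe z ⟨-z - z, hmem⟩
        simp only [add_sub_cancel, L.derivWeierstrassP_neg] at h1
        linear_combination -h1 / 2)
      refine ⟨-z, hz', hzz, by simp, mul_left_cancel₀ hu0 ?_⟩
      have h1 := L.zetaDefect_cubic hz hz' hzz
      rw [← hh, L.weierstrassP_neg] at h1
      linear_combination ε * L.zetaDefect z (-z - z) * hu - h1 + hH +
        L.derivWeierstrassP z * L.zetaDefect z (-z - z) * hε2
    -- The ordinate is forced: 2dW(z, a - z) = ℘'(a) + ℘'(z) has to equal 2εvd, and ℘'(z) = εu.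
    · obtain ⟨a, ha, hPa, hP'a⟩ := L.exists_weierstrassP_eq_and_derivWeierstrassP_eq
        (x := -f / 3 - d) (y := 2 * ε * v * d - ε * u) (by
          rw [hg2, hg3]
          linear_combination (4 * v ^ 2 * d ^ 2 - 4 * u * v * d + u ^ 2) * hε2 + 4 * d * hH)
      have hD : L.weierstrassP z - L.weierstrassP a = d := by rw [hPz, hPa]; ring
      have ham : a - z ∉ L.lattice := fun hmem ↦ hd (by
        rw [← hD, L.weierstrassP_eq_of_sub_mem hmem, sub_self])
      refine ⟨a, ha, ham, hD, mul_left_cancel₀ hd ?_⟩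
      have h1 := L.two_mul_sub_mul_zetaDefect_sub hz ha ham
      rw [hD, hP'a, hP'z] at h1
      linear_combination ε / 2 * h1 + v * d * hε2
  have key := elliptic_of_elliptic_at (z₀ := a - n₀ * z) hε hI hsol hn₀ hz hu hf (by
    rw [ellipticD, sub_add_cancel]
    exact ⟨ham, ha, hWa.symm, hPa.symm⟩)
  refine ⟨L, a - n₀ * z, z, ⟨hz, fun n hn ↦ ⟨?_, (key n hn).2.1⟩⟩, by rwa [L.deriv_weierstrassP],
    hf, by rwa [deriv_deriv_weierstrassP L hz], fun n hn ↦ ⟨?_, (key n hn).2.2.2⟩⟩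
  · rw [sub_one_mul, ← add_sub_assoc]
    exact (key n hn).1
  · rw [ellipticV_sub_one]
    exact (key n hn).2.2.1

end DToda

theorem mainTheorem6 :
    -- the map is symplectic, and `H` is a first integral with isolated critical points
    (∀ u f : ℂ,
      (∀ p : ℂ × ℂ, p.2 ≠ 0 →
        DifferentiableAt ℂ (DToda.map u f) p ∧
        DToda.symplecticForm.compContinuousLinearMap (fderiv ℂ (DToda.map u f) p)
          = DToda.symplecticForm ∧
        DToda.H u f (DToda.map u f p) = DToda.H u f p) ∧
      {p : ℂ × ℂ | fderiv ℂ (DToda.H u f) p = 0}.Finite) ∧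
    -- the elliptic formulas give solutions
    (∀ (L : PeriodPair) (z₀ z ε : ℂ) (I : Set ℤ), (ε = 1 ∨ ε = -1) →
      DToda.AvoidsPoles L z₀ z I →
        DToda.IsSolutionOn (ε * deriv L.weierstrassP z) (-3 * L.weierstrassP z) I
          (DToda.ellipticV ε L z₀ z) (DToda.ellipticD L z₀ z) ∧
        ∀ n ∈ I,
          DToda.H (ε * deriv L.weierstrassP z) (-3 * L.weierstrassP z)
              (DToda.ellipticV ε L z₀ z (n - 1), DToda.ellipticD L z₀ z n)
            = -(1 / 2) * deriv (deriv L.weierstrassP) z) ∧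
    -- every solution on a nonsingular level set of `H` is given by the elliptic formulas
    (∀ (u f h ε : ℂ) (I : Set ℤ) (v d : ℤ → ℂ) (n₀ : ℤ), (ε = 1 ∨ ε = -1) →
      DToda.IsNonsingularLevel u f h →
      I.OrdConnected → DToda.IsSolutionOn u f I v d →
      n₀ ∈ I → DToda.H u f (v (n₀ - 1), d n₀) = h →
        ∃ (L : PeriodPair) (z₀ z : ℂ),
          DToda.AvoidsPoles L z₀ z I ∧
          u = ε * deriv L.weierstrassP z ∧
          f = -3 * L.weierstrassP z ∧
          h = -(1 / 2) * deriv (deriv L.weierstrassP) z ∧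
          ∀ n ∈ I, v (n - 1) = DToda.ellipticV ε L z₀ z (n - 1) ∧
            d n = DToda.ellipticD L z₀ z n) := by
  exact ⟨fun u f ↦ ⟨fun p hp ↦ ⟨(DToda.hasFDerivAt_map u f p hp).differentiableAt,
      DToda.symplecticForm_compContinuousLinearMap_fderiv_map u f p hp, DToda.H_map u f p hp⟩,
      DToda.finite_fderiv_H_eq_zero u f⟩,
    fun _ _ _ _ _ hε h ↦ ⟨DToda.isSolutionOn_elliptic hε h, DToda.H_elliptic hε h⟩,
    fun _ _ _ _ _ _ _ _ hε hns hI hsol hn₀ hH ↦ DToda.exists_elliptic hε hns hI hsol hn₀ hH⟩
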